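/- Definitions. A tournament $T=(V,E)$ is a set $V$ of vertices (possibly empty) with an irreflexive, antisymmetric and complete binary relation $E$ on $V$; it is finite of size $m$ if $|V|=m$. A subtournament is the restriction of $T$ to a set of vertices. A tournament is acyclic if it contains no $3$-element cycle. A set $A\subseteq V$ is autonomous if for all $x,x'\in A$ and $y\notin A$: $(x,y)\in E$ if and only if $(x',y)\in E$. $T$ is acyclically indecomposable if no acyclic autonomous set of vertices has more than one element. For a vertex $x$, the acyclic component of $x$ is the union of all acyclic autonomous sets containing $x$ (it is the largest such set); the acyclic components partition $V$, and $\check T$ denotes the tournament whose vertices are the acyclic components of $T$, with an edge from a component $P$ to a different component $Q$ if $(x,y)\in E$ for some (equivalently, all) $x\in P$, $y\in Q$. For an acyclic tournament $C=(A,<)$, let $\mathfrak B_C:=\{C_{3[C]},V_{[C]},T_{[C]},U_{[C]},H_{[C]},K_{[C]}\}$, where: - $C_{3[C]}$ is the lexicographical sum, indexed by $C$, of copies of the $3$-cycle (each $x\in A$ is replaced by a $3$-cycle, and all edges go from the copy at $x$ to the copy at $y$ when $x<y$); - $V_{[C]}$ has vertex set $(A\times\{0,1\})\cup\{a\}$ with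 $a\notin A\times\{0,1\}$; its edges are the pairs $((x,i),(x',i'))$ with $x<x'$, or with $x=x'$ and $i<i'$, and the pairs $(a,(x,0))$ and $((x,1),a)$ for all $x\in A$; - $T_{[C]},U_{[C]},H_{[C]},K_{[C]}$ have vertex set $A\times\{0,1\}$. In each of them, $(x,0)\to(x,1)$ for all $x\in A$, and $(x,0)\to(y,0)$ whenever $x<y$. The remaining edges are, for all $x<y$ in $A$: - in $T_{[C]}$: $(y,1)\to(x,0)$, $(y,0)\to(x,1)$, $(x,1)\to(y,1)$; - in $U_{[C]}$: $(x,0)\to(y,1)$, $(x,1)\to(y,0)$, $(y,1)\to(x,1)$; - in $H_{[C]}$: $(y,1)\to(x,0)$, $(x,1)\to(y,0)$, $(x,1)\to(y,1)$; - in $K_{[C]}$: $(y,1)\to(x,0)$, $(x,1)\to(y,0)$, $(y,1)\to(x,1)$. For a non-negative integer $n$ let $\underline n$ be the acyclic tournament on $\{0,\dots,n-1\}$ given by the natural strict order, and let $\check{\mathfrak B}_{\underline n}:=\{\check T: T\in\mathfrak B_{\underline n}\}$. Theorem. For every non-negative integer $n$ there is an integer $a(n)$ such that every finite tournament of size at least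 $a(n)$ which is acyclically indecomposable contains a subtournament isomorphic to a member of $\check{\mathfrak B}_{\underline n}$. -/

import Mathlib

universe u v

/-- A tournament on the vertex set `V`: a digraph (`Adj x y` means that `(x, y)` is an edge) whose
edge relation is irreflexive, antisymmetric and complete. The vertex set may be empty. -/
structure Tournament (V : Type u) extends Digraph V where
  irrefl : ∀ x, ¬ Adj x x
  antisymm : ∀ x y, Adj x y → Adj y x → x = y
  complete : ∀ x y, x ≠ y → Adj x y ∨ Adj y x

namespace Tournament

variable {V : Type u} {W : Type v}

theorem asymm (T : Tournament V) {x y : V} (h : T.Adj x y) : ¬ T.Adj y x := by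
  intro h'
  have := T.antisymm x y h h'
  subst this
  exact T.irrefl _ h

/-- The tournament induced on a set `S` of vertices. -/
def restrict (T : Tournament V) (S : Set V) : Tournament S where
  Adj x y := T.Adj x y
  irrefl x := T.irrefl x
  antisymm x y h h' := Subtype.ext (T.antisymm x y h h')
  complete x y h := T.complete x y (fun e => h (Subtype.ext e))

/-- `T` and `T'` are isomorphic. -/
def IsIsomorphicTo (T : Tournament V) (T' : Tournament W) : Prop :=
  Nonempty (T.Adj ≃r T'.Adj)

/-- `T` is embeddable into `T'`: it is isomorphic to a subtournament of `T'`. -/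
def IsEmbeddableInto (T : Tournament V) (T' : Tournament W) : Prop :=
  ∃ S : Set W, T.IsIsomorphicTo (T'.restrict S)

/-- `T` is acyclic: it contains no 3-element cycle. -/
def IsAcyclic (T : Tournament V) : Prop :=
  ∀ x y z : V, ¬ (T.Adj x y ∧ T.Adj y z ∧ T.Adj z x)

/-- A set `A` of vertices is autonomous if no vertex outside `A` distinguishes two vertices
of `A`. -/
def IsAutonomous (T : Tournament V) (A : Set V) : Prop :=
  ∀ x ∈ A, ∀ x' ∈ A, ∀ y ∉ A, (T.Adj x y ↔ T.Adj x' y)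

/-- No acyclic autonomous set of vertices has more than one element. -/
def IsAcyclicallyIndecomposable (T : Tournament V) : Prop :=
  ∀ A : Set V, T.IsAutonomous A → (T.restrict A).IsAcyclic → A.Subsingleton

/-! ### Acyclic components and the tournament indexing them -/

/-- The union of all acyclic autonomous sets of vertices that contain `x`. -/
def acyclicComponent (T : Tournament V) (x : V) : Set V :=
  ⋃₀ {A | T.IsAutonomous A ∧ (T.restrict A).IsAcyclic ∧ x ∈ A}

/-- The set of all acyclic components of `T`. -/
def acyclicComponents (T : Tournament V) : Set (Set V) :=
  Set.range T.acyclicComponent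

theorem IsAutonomous.adj_iff {T : Tournament V} {A : Set V} (hA : T.IsAutonomous A)
    {x x' y : V} (hx : x ∈ A) (hx' : x' ∈ A) (hy : y ∉ A) : T.Adj y x ↔ T.Adj y x' := by
  have h := hA x hx x' hx' y hy
  have aux : ∀ z ∈ A, (T.Adj y z ↔ ¬ T.Adj z y) := fun z hz =>
    ⟨fun h => T.asymm h, fun h =>
      (T.complete y z (fun e => hy (e ▸ hz))).resolve_right h⟩
  rw [aux x hx, aux x' hx', h]

theorem IsAutonomous.union {T : Tournament V} {A B : Set V} (hA : T.IsAutonomous A)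
    (hB : T.IsAutonomous B) {z : V} (hzA : z ∈ A) (hzB : z ∈ B) : T.IsAutonomous (A ∪ B) := by
  have key : ∀ x ∈ A ∪ B, ∀ y ∉ A ∪ B, (T.Adj x y ↔ T.Adj z y) := by
    rintro x (hx | hx) y hy
    · exact hA x hx z hzA y (fun h => hy (Or.inl h))
    · exact hB x hx z hzB y (fun h => hy (Or.inr h))
  intro x hx x' hx' y hy
  rw [key x hx y hy, key x' hx' y hy]

theorem isAcyclic_restrict_union {T : Tournament V} {A B : Set V} (hA : T.IsAutonomous A)
    (hB : T.IsAutonomous B) (hA' : (T.restrict A).IsAcyclic) (hB' : (T.restrict B).IsAcyclic) :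
    (T.restrict (A ∪ B)).IsAcyclic := by
  -- a 3-cycle with two vertices in an acyclic autonomous set is impossible
  have key : ∀ D : Set V, T.IsAutonomous D → (T.restrict D).IsAcyclic → ∀ x ∈ D, ∀ y ∈ D, ∀ z,
      T.Adj x y → T.Adj y z → T.Adj z x → False := by
    intro D hD hD' x hx y hy z h1 h2 h3
    by_cases hz : z ∈ D
    · exact hD' ⟨x, hx⟩ ⟨y, hy⟩ ⟨z, hz⟩ ⟨h1, h2, h3⟩
    · exact T.asymm h3 ((hD x hx y hy z hz).2 h2)
  rintro ⟨x, hx⟩ ⟨y, hy⟩ ⟨z, hz⟩ ⟨h1, h2, h3⟩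
  have h1 : T.Adj x y := h1
  have h2 : T.Adj y z := h2
  have h3 : T.Adj z x := h3
  rcases hx with hx | hx <;> rcases hy with hy | hy <;> rcases hz with hz | hz
  · exact key A hA hA' x hx y hy z h1 h2 h3
  · exact key A hA hA' x hx y hy z h1 h2 h3
  · exact key A hA hA' z hz x hx y h3 h1 h2
  · exact key B hB hB' y hy z hz x h2 h3 h1
  · exact key A hA hA' y hy z hz x h2 h3 h1
  · exact key B hB hB' z hz x hx y h3 h1 h2
  · exact key B hB hB' x hx y hy z h1 h2 h3
  · exact key B hB hB' x hx y hy z h1 h2 h3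

theorem mem_acyclicComponent_self (T : Tournament V) (x : V) : x ∈ T.acyclicComponent x := by
  refine ⟨{x}, ⟨?_, ?_, rfl⟩, rfl⟩
  · rintro a rfl b rfl y _
    rfl
  · rintro ⟨a, ha⟩ ⟨b, hb⟩ ⟨c, hc⟩ ⟨h, -, -⟩
    have h : T.Adj a b := h
    rw [Set.mem_singleton_iff.1 ha, Set.mem_singleton_iff.1 hb] at h
    exact T.irrefl _ h

theorem isAutonomous_acyclicComponent (T : Tournament V) (x : V) :
    T.IsAutonomous (T.acyclicComponent x) := by
  have key : ∀ a ∈ T.acyclicComponent x, ∀ y ∉ T.acyclicComponent x,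
      (T.Adj a y ↔ T.Adj x y) := by
    rintro a ⟨A, hA, haA⟩ y hy
    exact hA.1 a haA x hA.2.2 y (fun h => hy ⟨A, hA, h⟩)
  intro a ha b hb y hy
  rw [key a ha y hy, key b hb y hy]

theorem acyclicComponent_eq_of_mem (T : Tournament V) {x y : V}
    (h : y ∈ T.acyclicComponent x) : T.acyclicComponent y = T.acyclicComponent x := by
  obtain ⟨A, ⟨hA1, hA2, hxA⟩, hyA⟩ := h
  apply Set.Subset.antisymm
  · rintro z ⟨B, ⟨hB1, hB2, hyB⟩, hzB⟩
    exact ⟨A ∪ B, ⟨hA1.union hB1 hyA hyB, isAcyclic_restrict_union hA1 hB1 hA2 hB2, Or.inl hxA⟩,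
      Or.inr hzB⟩
  · rintro z ⟨B, ⟨hB1, hB2, hxB⟩, hzB⟩
    exact ⟨A ∪ B, ⟨hA1.union hB1 hxA hxB, isAcyclic_restrict_union hA1 hB1 hA2 hB2, Or.inl hyA⟩,
      Or.inr hzB⟩

/-- Edges between distinct acyclic components do not depend on the chosen vertices. -/
theorem adj_iff_of_acyclicComponent_eq (T : Tournament V) {x x' y y' : V}
    (hx : T.acyclicComponent x = T.acyclicComponent x')
    (hy : T.acyclicComponent y = T.acyclicComponent y')
    (hxy : T.acyclicComponent x ≠ T.acyclicComponent y) : T.Adj x y ↔ T.Adj x' y' := by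
  have h1 : y ∉ T.acyclicComponent x := fun h => hxy (T.acyclicComponent_eq_of_mem h).symm
  have h2 : x' ∉ T.acyclicComponent y := fun h =>
    hxy (hx.trans (T.acyclicComponent_eq_of_mem h))
  rw [T.isAutonomous_acyclicComponent x x (T.mem_acyclicComponent_self x) x'
      (hx ▸ T.mem_acyclicComponent_self x') y h1,
    (T.isAutonomous_acyclicComponent y).adj_iff (T.mem_acyclicComponent_self y)
      (hy ▸ T.mem_acyclicComponent_self y') h2]

/-- The tournament indexing the acyclic components of `T`: its vertices are the acyclic components
of `T`, and its edges are the pairs of distinct components of `x` and of `y`, where `(x, y)` is an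
edge of `T`. -/
def check (T : Tournament V) : Tournament T.acyclicComponents where
  Adj P Q := P ≠ Q ∧
    ∃ x y : V, P.1 = T.acyclicComponent x ∧ Q.1 = T.acyclicComponent y ∧ T.Adj x y
  irrefl P h := h.1 rfl
  antisymm P Q := by
    rintro ⟨hPQ, x, y, hx, hy, h⟩ ⟨-, y', x', hy', hx', h'⟩
    have hne : T.acyclicComponent x ≠ T.acyclicComponent y := fun e =>
      hPQ (Subtype.ext (hx.trans (e.trans hy.symm)))
    exact absurd h' (T.asymm
      ((T.adj_iff_of_acyclicComponent_eq (hx.symm.trans hx') (hy.symm.trans hy') hne).1 h))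
  complete := by
    rintro ⟨_, x, rfl⟩ ⟨_, y, rfl⟩ hne
    have hxy : x ≠ y := by
      rintro rfl
      exact hne rfl
    rcases T.complete x y hxy with h | h
    · exact Or.inl ⟨hne, x, y, rfl, rfl, h⟩
    · exact Or.inr ⟨hne.symm, y, x, rfl, rfl, h⟩

/-! ### The six tournaments attached to an acyclic tournament

The constructions below make sense for, and are written for, any tournament `C`. -/

/-- The acyclic tournament on `{0, …, n - 1}` given by the natural strict order. -/
def linear (n : ℕ) : Tournament (Fin n) where
  Adj x y := x < y
  irrefl x := lt_irrefl x
  antisymm _ _ h h' := absurd h' (lt_asymm h)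
  complete _ _ h := lt_or_gt_of_ne h

/-- The 3-cycle `0 → 1 → 2 → 0`. -/
def cycle3 : Tournament (Fin 3) where
  Adj x y := y = x + 1
  irrefl := by decide
  antisymm := by decide
  complete := by decide

/-- The lexicographical sum of the tournaments `T i` indexed by the tournament `D`. -/
def lexSum {I : Type u} {V : I → Type v} (D : Tournament I) (T : ∀ i, Tournament (V i)) :
    Tournament (Σ i, V i) where
  Adj p q := D.Adj p.1 q.1 ∨ ∃ h : p.1 = q.1, (T q.1).Adj (h ▸ p.2) q.2
  irrefl := by
    rintro ⟨i, x⟩ (h | ⟨_, h⟩)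
    · exact D.irrefl _ h
    · exact (T i).irrefl _ h
  antisymm := by
    rintro ⟨i, x⟩ ⟨j, y⟩ (h | ⟨e, h⟩) (h' | ⟨e', h'⟩)
    · exact absurd h' (D.asymm h)
    · dsimp only at e'
      subst e'
      exact absurd h (D.irrefl _)
    · dsimp only at e
      subst e
      exact absurd h' (D.irrefl _)
    · dsimp only at e
      subst e
      exact absurd h' ((T i).asymm h)
  complete := by
    rintro ⟨i, x⟩ ⟨j, y⟩ hne
    by_cases e : i = j
    · subst e
      have hxy : x ≠ y := by
        rintro rfl
        exact hne rfl
      exact ((T i).complete x y hxy).imp (fun h => Or.inr ⟨rfl, h⟩) (fun h => Or.inr ⟨rfl, h⟩)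
    · exact (D.complete i j e).imp Or.inl Or.inl

/-- `C₃[C]`: the lexicographical product `C₃.C`, that is, the lexicographical sum indexed by `C` of
copies of the 3-cycle. -/
def C3 (C : Tournament V) : Tournament (Σ _ : V, Fin 3) :=
  lexSum C (fun _ => cycle3)

/-- The edge relation of `V[C]`; the extra vertex `a` is `none`. -/
def VAdj (C : Tournament V) : Option (V × Fin 2) → Option (V × Fin 2) → Prop
  | some (x, i), some (x', i') => C.Adj x x' ∨ (x = x' ∧ i < i')
  | none, some (_, i') => i' = 0
  | some (_, i), none => i = 1
  | none, none => False

/-- `V[C]`: the lexicographical product of the 2-element tournament by `C`, with an additional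
vertex `a` such that `a → (x, 0)` and `(x, 1) → a` for all `x`. -/
def VT (C : Tournament V) : Tournament (Option (V × Fin 2)) where
  Adj := C.VAdj
  irrefl := by
    rintro (_ | ⟨x, i⟩) h
    · exact h
    · rcases h with h | ⟨_, h⟩
      · exact C.irrefl _ h
      · exact lt_irrefl _ h
  antisymm := by
    rintro (_ | ⟨x, i⟩) (_ | ⟨y, j⟩) h h'
    · rfl
    · simp only [VAdj] at h h'
      omega
    · simp only [VAdj] at h h'
      omega
    · exfalso
      rcases h with h | ⟨e, h⟩ <;> rcases h' with h' | ⟨e', h'⟩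
      · exact C.asymm h h'
      · exact C.irrefl _ (e' ▸ h)
      · exact C.irrefl _ (e ▸ h')
      · exact lt_asymm h h'
  complete := by
    rintro (_ | ⟨x, i⟩) (_ | ⟨y, j⟩) hne
    · exact absurd rfl hne
    · simp only [VAdj]
      omega
    · simp only [VAdj]
      omega
    · by_cases e : x = y
      · subst e
        have hij : i ≠ j := by
          rintro rfl
          exact hne rfl
        exact (lt_or_gt_of_ne hij).imp (fun h => Or.inr ⟨rfl, h⟩) (fun h => Or.inr ⟨rfl, h⟩)
      · exact (C.complete x y e).imp Or.inl Or.inl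

/-- Pairs of elements of `2 × 2`, where `2 = {0, 1}`. -/
abbrev Pair : Type := (Fin 2 × Fin 2) × (Fin 2 × Fin 2)

/-- `h i = ((0, i), (1, i))`. -/
def h (i : Fin 2) : Pair := ((0, i), (1, i))

/-- `v i = ((i, 0), (i, 1))`. -/
def v (i : Fin 2) : Pair := ((i, 0), (i, 1))

/-- `d i = ((0, i), (1, i + 1))`, with `i + 1` taken modulo 2. -/
def d (i : Fin 2) : Pair := ((0, i), (1, i + 1))

/-- The directed graph `Δ(C, X)` on `V × {0, 1}`. -/
def Delta (C : Tournament V) (X : Finset Pair) : Digraph (V × Fin 2) where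
  Adj p q :=
    (p.1 = q.1 ∧ ((0, p.2), (0, q.2)) ∈ X) ∨
    (C.Adj p.1 q.1 ∧ ((0, p.2), (1, q.2)) ∈ X) ∨
    (C.Adj q.1 p.1 ∧ ((1, p.2), (0, q.2)) ∈ X)

/-- The condition on `X` under which `Δ(C, X)` is a tournament. -/
def IsGood (X : Finset Pair) : Prop :=
  (∀ i j : Fin 2, ((0, i), (0, j)) ∈ X ↔ (i ≠ j ∧ ((0, j), (0, i)) ∉ X)) ∧
  (∀ i j : Fin 2, ((0, i), (1, j)) ∈ X ↔ ((1, j), (0, i)) ∉ X)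

instance (X : Finset Pair) : Decidable (IsGood X) := by
  unfold IsGood
  infer_instance

/-- `Δ(C, X)` as a tournament. -/
def deltaTournament (C : Tournament V) (X : Finset Pair) (hX : IsGood X) :
    Tournament (V × Fin 2) where
  toDigraph := C.Delta X
  irrefl := by
    rintro ⟨x, i⟩ (⟨_, h⟩ | ⟨h, _⟩ | ⟨h, _⟩)
    · exact ((hX.1 i i).1 h).1 rfl
    · exact C.irrefl _ h
    · exact C.irrefl _ h
  antisymm := by
    rintro ⟨x, i⟩ ⟨y, j⟩ h h'
    exfalso
    simp only [Delta] at h h'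
    rcases h with ⟨e, h⟩ | ⟨e, h⟩ | ⟨e, h⟩ <;> rcases h' with ⟨e', h'⟩ | ⟨e', h'⟩ | ⟨e', h'⟩
    · exact ((hX.1 i j).1 h).2 h'
    · exact C.irrefl _ (e ▸ e')
    · exact C.irrefl _ (e ▸ e')
    · exact C.irrefl _ (e' ▸ e)
    · exact C.asymm e e'
    · exact (hX.2 i j).1 h h'
    · exact C.irrefl _ (e' ▸ e)
    · exact (hX.2 j i).1 h' h
    · exact C.asymm e e'
  complete := by
    rintro ⟨x, i⟩ ⟨y, j⟩ hne
    simp only [Delta]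
    by_cases e : x = y
    · subst e
      have hij : i ≠ j := by
        rintro rfl
        exact hne rfl
      by_cases h : ((0, j), (0, i)) ∈ X
      · exact Or.inr (Or.inl ⟨rfl, h⟩)
      · exact Or.inl (Or.inl ⟨rfl, (hX.1 i j).2 ⟨hij, h⟩⟩)
    · rcases C.complete x y e with h | h
      · by_cases h' : ((1, j), (0, i)) ∈ X
        · exact Or.inr (Or.inr (Or.inr ⟨h, h'⟩))
        · exact Or.inl (Or.inr (Or.inl ⟨h, (hX.2 i j).2 h'⟩))
      · by_cases h' : ((1, i), (0, j)) ∈ X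
        · exact Or.inl (Or.inr (Or.inr ⟨h, h'⟩))
        · exact Or.inr (Or.inr (Or.inl ⟨h, (hX.2 j i).2 h'⟩))

/-- `T[C]`. -/
def TT (C : Tournament V) : Tournament (V × Fin 2) :=
  C.deltaTournament {(d 0).swap, (d 1).swap, h 1, h 0, v 0} (by decide)

/-- `U[C]`. -/
def UT (C : Tournament V) : Tournament (V × Fin 2) :=
  C.deltaTournament {d 0, d 1, (h 1).swap, h 0, v 0} (by decide)

/-- `H[C]`. -/
def HT (C : Tournament V) : Tournament (V × Fin 2) :=
  C.deltaTournament {(d 0).swap, d 1, h 1, h 0, v 0} (by decide)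

/-- `K[C]`. -/
def KT (C : Tournament V) : Tournament (V × Fin 2) :=
  C.deltaTournament {(d 0).swap, d 1, (h 1).swap, h 0, v 0} (by decide)

/-- The set `𝔅_C` consisting of the six tournaments attached to `C`. A tournament is bundled with
its type of vertices. -/
def familyB (C : Tournament V) : Set (Σ W : Type u, Tournament W) :=
  {⟨_, C.C3⟩, ⟨_, C.VT⟩, ⟨_, C.TT⟩, ⟨_, C.UT⟩, ⟨_, C.HT⟩, ⟨_, C.KT⟩}

/-- The set `{Ť : T ∈ 𝔅_C}`. -/
def checkFamilyB (C : Tournament V) : Set (Σ W : Type u, Tournament W) :=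
  (fun T => ⟨T.2.acyclicComponents, T.2.check⟩) '' C.familyB

end Tournament

/-!
Suppose that no member of `𝔅_n` maps to `T`. Take a long acyclic subtournament and cut it into
consecutive edges `x i → y i`. The vertices lying between `x i` and `y i`, together with `x i` and
`y i`, do not form an acyclic autonomous set: some 3-cycle witnesses this. By Ramsey's theorem we
may assume that all these witnesses are of the same kind and that the adjacency of the vertices
attached to `i < j` does not depend on `i` and `j`. Two sequences `p`, `q` with `p i → q i` for all
`i`, at least one of which is increasing, then either contain a copy of `T[n]`, `U[n]`, `H[n]` or
`K[n]`, or satisfy `p i → q j` for all `i` and `j`, or interleave into an acyclic tournament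
`p 0 → q 0 → p 1 → q 1 → ⋯`. But apply this to the edges of the witnessing 3-cycles: the second
alternative yields a copy of `V[n]`, and the third, when it holds for all three edges, a copy of
`C₃[n]`.
-/

section Ramsey

open Finset

theorem exists_orderEmbedding_const {α κ : Type*} [LinearOrder α] [Fintype κ] [Nonempty κ] {n : ℕ}
    (f : α → κ) {S : Finset α} (hS : Fintype.card κ * n ≤ #S) :
    ∃ (g : Fin n ↪o α) (c : κ), ∀ i, g i ∈ S ∧ f (g i) = c := by
  classical
  obtain ⟨c, -, hc⟩ := exists_le_card_fiber_of_mul_le_card_of_maps_to (f := f)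
    (fun a _ => mem_univ (f a)) univ_nonempty (by rwa [card_univ])
  exact ⟨orderEmbOfCardLe _ hc, c, fun i => mem_filter.1 (orderEmbOfCardLe_mem _ hc i)⟩

/-- A colouring of pairs is end-homogeneous on `A` if the colour of a pair of elements of `A`
depends only on its smaller element. This is the intermediate notion in the proof of Ramsey's
theorem. -/
def EndHomogeneousOn {α κ : Type*} [LT α] (col : α → α → κ) (A : Finset α) : Prop :=
  ∃ d : α → κ, ∀ a ∈ A, ∀ b ∈ A, a < b → col a b = d a

theorem EndHomogeneousOn.insert {α κ : Type*} [LinearOrder α] {col : α → α → κ} {A : Finset α}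
    (hA : EndHomogeneousOn col A) {m : α} {k : κ} (hm : ∀ a ∈ A, m < a ∧ col m a = k) :
    EndHomogeneousOn col (insert m A) := by
  obtain ⟨d, hd⟩ := hA
  refine ⟨Function.update d m k, fun a ha b hb hab => ?_⟩
  have hmb : b ∈ A := by
    refine mem_of_mem_insert_of_ne hb ?_
    rintro rfl
    rcases mem_insert.1 ha with rfl | ha
    exacts [hab.false, hab.asymm (hm a ha).1]
  rcases mem_insert.1 ha with rfl | ha
  · rw [Function.update_self, (hm b hmb).2]
  · rw [Function.update_of_ne (hm a ha).1.ne', hd a ha b hmb hab]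

theorem exists_endHomogeneousOn (κ : Type*) [Finite κ] [Nonempty κ] (n : ℕ) :
    ∃ N : ℕ, ∀ {α : Type u} [LinearOrder α] (col : α → α → κ) (S : Finset α), N ≤ #S →
      ∃ A ⊆ S, n ≤ #A ∧ EndHomogeneousOn col A := by
  classical
  cases nonempty_fintype κ
  induction n with
  | zero =>
    exact ⟨0, fun {α} _ col S _ =>
      ⟨∅, empty_subset S, le_rfl, fun _ => Classical.arbitrary κ, by simp⟩⟩
  | succ n ih =>
    obtain ⟨N, hN⟩ := ih
    refine ⟨Fintype.card κ * N + 1, fun {α} _ col S hS => ?_⟩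
    have hS₀ : S.Nonempty := card_pos.1 (by omega)
    set m := S.min' hS₀
    have hm : m ∈ S := S.min'_mem hS₀
    obtain ⟨k, -, hk⟩ := exists_le_card_fiber_of_mul_le_card_of_maps_to (s := S.erase m)
      (f := col m) (n := N) (fun a _ => mem_univ (col m a)) univ_nonempty
      (by rw [card_univ, card_erase_of_mem hm]; omega)
    obtain ⟨A, hAS, hA, hcol⟩ := hN col _ hk
    have hmA : ∀ a ∈ A, m < a ∧ col m a = k := fun a ha =>
      ⟨S.min'_lt_of_mem_erase_min' hS₀ (mem_filter.1 (hAS ha)).1, (mem_filter.1 (hAS ha)).2⟩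
    refine ⟨insert m A, insert_subset hm ?_, ?_, hcol.insert hmA⟩
    · exact hAS.trans ((filter_subset _ _).trans (erase_subset _ _))
    · rw [card_insert_of_notMem fun h => (hmA m h).1.false]
      omega

theorem exists_orderEmbedding_pairwise_const (κ : Type*) [Finite κ] [Nonempty κ] (n : ℕ) :
    ∃ N : ℕ, ∀ col : Fin N → Fin N → κ,
      ∃ (g : Fin n ↪o Fin N) (c : κ), ∀ i j, i < j → col (g i) (g j) = c := by
  cases nonempty_fintype κ
  obtain ⟨N, hN⟩ := exists_endHomogeneousOn κ (Fintype.card κ * n)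
  refine ⟨N, fun col => ?_⟩
  obtain ⟨A, -, hA, d, hd⟩ := hN col univ (card_fin N).ge
  obtain ⟨g, c, hg⟩ := exists_orderEmbedding_const d hA
  refine ⟨g, c, fun i j hij => ?_⟩
  rw [hd _ (hg i).1 _ (hg j).1 (g.strictMono hij), (hg i).2]

end Ramsey

namespace Tournament

section Homomorphisms

variable {V : Type u} {W : Type v}

theorem trichotomous (T : Tournament V) : Std.Trichotomous T.Adj where
  trichotomous x y hxy hyx := by
    by_contra hne
    exact (T.complete x y hne).elim hxy hyx

theorem isEmbeddableInto_of_relHom {S : Tournament W} {T : Tournament V}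
    (f : S.Adj →r T.Adj) : S.IsEmbeddableInto T := by
  have := S.trichotomous
  have : Std.Asymm T.Adj := ⟨fun _ _ => T.asymm⟩
  let e : S.Adj ↪r T.Adj := RelEmbedding.ofMonotone f fun _ _ => f.map_rel
  exact ⟨Set.range e, ⟨Equiv.ofInjective e e.injective, e.map_rel_iff⟩⟩

theorem nonempty_relHom_check (B : Tournament W) : Nonempty (B.check.Adj →r B.Adj) := by
  choose r hr using fun P : B.acyclicComponents => P.2
  refine ⟨⟨r, ?_⟩⟩
  rintro P Q ⟨hne, x, y, hx, hy, hxy⟩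
  refine (B.adj_iff_of_acyclicComponent_eq (hx.symm.trans (hr P).symm)
    (hy.symm.trans (hr Q).symm) fun hc => hne (Subtype.ext ?_)).1 hxy
  rw [hx, hc, hy]

end Homomorphisms

section Obstructions

variable {V : Type u} (T : Tournament V)

/-- The vertices lying between `x` and `y`. -/
def openInterval (x y : V) : Set V := {z | T.Adj x z ∧ T.Adj z y}

/-- The vertices `x` and `y` and those lying between them. For `x → y`, it is the set which acyclic
indecomposability prevents from being acyclic and autonomous. -/
def closedInterval (x y : V) : Set V := insert x (insert y (T.openInterval x y))

/-- The kinds of 3-cycles by which the closed interval of an edge can fail to be acyclic and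
autonomous. -/
inductive ObstructionKind
  /-- The edge itself lies on a 3-cycle. -/
  | triangle
  /-- The open interval contains a 3-cycle. -/
  | cycle
  /-- An edge from the source to the open interval lies on a 3-cycle. -/
  | lower
  /-- An edge from the open interval to the target lies on a 3-cycle. -/
  | upper

instance : Finite ObstructionKind :=
  .of_surjective ![.triangle, .cycle, .lower, .upper] fun
    | .triangle => ⟨0, rfl⟩
    | .cycle => ⟨1, rfl⟩
    | .lower => ⟨2, rfl⟩
    | .upper => ⟨3, rfl⟩

/-- The vertices `a`, `b`, `c` form an obstruction of the given kind to the closed interval of the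
edge `x → y` being acyclic and autonomous. Only the obstructions of kind `cycle` use all three of
them. -/
def IsObstruction (x y a b c : V) : ObstructionKind → Prop
  | .triangle => T.Adj y a ∧ T.Adj a x
  | .cycle => (a ∈ T.openInterval x y ∧ b ∈ T.openInterval x y ∧ c ∈ T.openInterval x y) ∧
      T.Adj a b ∧ T.Adj b c ∧ T.Adj c a
  | .lower => a ∈ T.openInterval x y ∧ T.Adj a b ∧ T.Adj b x
  | .upper => a ∈ T.openInterval x y ∧ T.Adj y b ∧ T.Adj b a

variable {T} {x y : V}

theorem mem_openInterval_of_adj (hxy : T.Adj x y) {p q r : V} (hp : p ∈ T.closedInterval x y)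
    (hq : q ∈ T.closedInterval x y) (hr : r ∈ T.closedInterval x y) (hqp : T.Adj q p)
    (hpr : T.Adj p r) : p ∈ T.openInterval x y := by
  rcases hp with rfl | rfl | hp
  · rcases hq with rfl | rfl | hq
    exacts [(T.irrefl _ hqp).elim, (T.asymm hxy hqp).elim, (T.asymm hq.1 hqp).elim]
  · rcases hr with rfl | rfl | hr
    exacts [(T.asymm hxy hpr).elim, (T.irrefl _ hpr).elim, (T.asymm hr.2 hpr).elim]
  · exact hp

theorem exists_isObstruction_of_not_isAcyclic (hxy : T.Adj x y)
    (hA : ¬ (T.restrict (T.closedInterval x y)).IsAcyclic) :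
    ∃ a b c, T.IsObstruction x y a b c .cycle := by
  unfold IsAcyclic at hA
  push Not at hA
  obtain ⟨⟨p, hp⟩, ⟨q, hq⟩, ⟨r, hr⟩, hpq, hqr, hrp⟩ := hA
  exact ⟨p, q, r, ⟨mem_openInterval_of_adj hxy hp hr hq hrp hpq,
    mem_openInterval_of_adj hxy hq hp hr hpq hqr, mem_openInterval_of_adj hxy hr hq hp hqr hrp⟩,
    hpq, hqr, hrp⟩

theorem exists_isObstruction_of_not_isAutonomous
    (hA : ¬ T.IsAutonomous (T.closedInterval x y)) :
    ∃ a b k, T.IsObstruction x y a b b k := by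
  obtain ⟨p, hp, w, hw, hne⟩ : ∃ p ∈ T.closedInterval x y, ∃ w ∉ T.closedInterval x y,
      ¬ (T.Adj p w ↔ T.Adj x w) := by
    by_contra! h
    exact hA fun p hp q hq w hw => (h p hp w hw).trans (h q hq w hw).symm
  simp only [closedInterval, Set.mem_insert_iff, not_or] at hw
  obtain ⟨hwx, hwy, hw⟩ := hw
  have hwp : w ≠ p := by
    rintro rfl
    exact hp.elim hwx fun hp => hp.elim hwy hw
  by_cases hxw : T.Adj x w
  · have hyw : T.Adj y w := (T.complete w y hwy).resolve_left fun h => hw ⟨hxw, h⟩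
    have hwp : T.Adj w p := (T.complete w p hwp).resolve_right fun h => hne (iff_of_true h hxw)
    rcases hp with rfl | rfl | hp
    · exact (T.asymm hxw hwp).elim
    · exact (T.asymm hyw hwp).elim
    · exact ⟨p, w, .upper, hp, hyw, hwp⟩
  · have hwx : T.Adj w x := (T.complete w x hwx).resolve_right hxw
    have hpw : T.Adj p w := by
      by_contra h
      exact hne (iff_of_false h hxw)
    rcases hp with rfl | rfl | hp
    · exact (hxw hpw).elim
    · exact ⟨w, w, .triangle, hpw, hwx⟩
    · exact ⟨p, w, .lower, hp, hpw, hwx⟩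

theorem IsAcyclicallyIndecomposable.exists_isObstruction (hT : T.IsAcyclicallyIndecomposable)
    (hxy : T.Adj x y) : ∃ a b c k, T.IsObstruction x y a b c k := by
  by_cases hA : T.IsAutonomous (T.closedInterval x y)
  · obtain ⟨a, b, c, h⟩ := exists_isObstruction_of_not_isAcyclic hxy fun hA' => by
      obtain rfl : x = y := hT _ hA hA' (.inl rfl) (.inr (.inl rfl))
      exact T.irrefl x hxy
    exact ⟨a, b, c, .cycle, h⟩
  · obtain ⟨a, b, k, h⟩ := exists_isObstruction_of_not_isAutonomous hA
    exact ⟨a, b, b, k, h⟩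

end Obstructions

section Sequences

section Definitions

variable {V : Type u} (T : Tournament V) {I : Type*}

/-- All edges `p i → q i`. -/
def PointwiseAdj (p q : I → V) : Prop := ∀ i, T.Adj (p i) (q i)

/-- All edges `p i → q j`. -/
def Dominates (p q : I → V) : Prop := ∀ i j, T.Adj (p i) (q j)

/-- All edges `p i → q j` with `i < j`. In particular, `Forward p p` says that `p` is increasing. -/
def Forward [LT I] (p q : I → V) : Prop := ∀ ⦃i j⦄, i < j → T.Adj (p i) (q j)

/-- All edges `q j → p i` with `i < j`: the reverses of the edges of `Forward p q`. -/
def Backward [LT I] (p q : I → V) : Prop := ∀ ⦃i j⦄, i < j → T.Adj (q j) (p i)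

/-- The vertices of `p` and `q`, enumerated as `p 0, q 0, p 1, q 1, …`, form an acyclic tournament
whose edges all go forward. -/
structure Interleaved [LT I] (p q : I → V) : Prop where
  adj : T.PointwiseAdj p q
  left : T.Forward p p
  right : T.Forward q q
  left_right : T.Forward p q
  right_left : T.Forward q p

end Definitions

variable {V : Type u} {T : Tournament V} {I J : Type*} {p q : I → V}

theorem Dominates.of_comp_surjective {φ : J → I} (h : T.Dominates (p ∘ φ) (q ∘ φ))
    (hφ : φ.Surjective) : T.Dominates p q :=
  hφ.forall₂.2 h

section Preorder

variable [Preorder I] [Preorder J]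

theorem Forward.comp_strictMono (h : T.Forward p q) {φ : J → I} (hφ : StrictMono φ) :
    T.Forward (p ∘ φ) (q ∘ φ) :=
  fun _ _ hij => h (hφ hij)

theorem Backward.comp_strictMono (h : T.Backward p q) {φ : J → I} (hφ : StrictMono φ) :
    T.Backward (p ∘ φ) (q ∘ φ) :=
  fun _ _ hij => h (hφ hij)

theorem Forward.comp_strictAnti (h : T.Forward q p) {φ : J → I} (hφ : StrictAnti φ) :
    T.Backward (p ∘ φ) (q ∘ φ) :=
  fun _ _ hij => h (hφ hij)

theorem Backward.comp_strictAnti (h : T.Backward q p) {φ : J → I} (hφ : StrictAnti φ) :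
    T.Forward (p ∘ φ) (q ∘ φ) :=
  fun _ _ hij => h (hφ hij)

theorem Interleaved.comp_strictMono (h : T.Interleaved p q) {φ : J → I} (hφ : StrictMono φ) :
    T.Interleaved (p ∘ φ) (q ∘ φ) where
  adj i := h.adj (φ i)
  left := h.left.comp_strictMono hφ
  right := h.right.comp_strictMono hφ
  left_right := h.left_right.comp_strictMono hφ
  right_left := h.right_left.comp_strictMono hφ

end Preorder

section LinearOrder

variable [LinearOrder I]

theorem Forward.injective (h : T.Forward p p) : Function.Injective p :=
  .of_lt_imp_ne fun i j hij he => T.irrefl (p j) (by simpa only [he] using h hij)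

theorem Backward.injective (h : T.Backward p p) : Function.Injective p :=
  .of_lt_imp_ne fun i j hij he => T.irrefl (p j) (by simpa only [he] using h hij)

theorem PointwiseAdj.adj_of_le (h : T.PointwiseAdj p q) (hpq : T.Forward p q) {i j : I}
    (hij : i ≤ j) : T.Adj (p i) (q j) := by
  rcases hij.eq_or_lt with rfl | hij
  exacts [h i, hpq hij]

theorem PointwiseAdj.dominates (h : T.PointwiseAdj p q) (hpq : T.Forward p q)
    (hqp : T.Backward q p) : T.Dominates p q := fun i j =>
  (le_or_gt i j).elim (h.adj_of_le hpq) fun hji => hqp hji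

theorem Interleaved.adj_of_le (h : T.Interleaved p q) {i j : I} (hij : i ≤ j) :
    T.Adj (p i) (q j) :=
  h.adj.adj_of_le h.left_right hij

end LinearOrder

theorem Interleaved.shift {N : ℕ} {p q : Fin (N + 1) → V} (h : T.Interleaved p q) :
    T.Interleaved (q ∘ Fin.castSucc) (p ∘ Fin.succ) where
  adj _ := h.right_left Fin.castSucc_lt_succ
  left := h.right.comp_strictMono Fin.strictMono_castSucc
  right := h.left.comp_strictMono Fin.strictMono_succ
  left_right _ _ hij := h.right_left (Fin.castSucc_lt_succ_iff.2 hij.le)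
  right_left _ _ hij := h.adj_of_le (Fin.succ_le_castSucc_iff.2 hij)

theorem Forward.interleaved_even_odd {N : ℕ} {s : Fin (2 * N) → V} (hs : T.Forward s s) :
    T.Interleaved (fun i : Fin N => s ⟨2 * i, by lia⟩) (fun i => s ⟨2 * i + 1, by lia⟩) where
  adj i := hs (Fin.mk_lt_mk.2 (by lia))
  left i j hij := hs (Fin.mk_lt_mk.2 (by lia))
  right i j hij := hs (Fin.mk_lt_mk.2 (by lia))
  left_right i j hij := hs (Fin.mk_lt_mk.2 (by lia))
  right_left i j hij := hs (Fin.mk_lt_mk.2 (by lia))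

theorem interleaved_or_exists_between {N : ℕ} {p z q : Fin (N + 1) → V}
    (hpz : T.Dominates p z ∨ T.Interleaved p z) (hzq : T.Dominates z q ∨ T.Interleaved z q) :
    (T.Interleaved p z ∧ T.Interleaved z q) ∨ ∃ t, ∀ i, T.Adj (p i) (z t) ∧ T.Adj (z t) (q i) := by
  rcases hpz with hpz | hpz <;> rcases hzq with hzq | hzq
  · exact .inr ⟨0, fun i => ⟨hpz i 0, hzq 0 i⟩⟩
  · exact .inr ⟨0, fun i => ⟨hpz i 0, hzq.adj_of_le (Fin.zero_le i)⟩⟩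
  · exact .inr ⟨Fin.last N, fun i => ⟨hpz.adj_of_le (Fin.le_last i), hzq _ i⟩⟩
  · exact .inl ⟨hpz, hzq⟩

end Sequences

section Patterns

variable {V : Type u} (T : Tournament V)

/-- Some member of `𝔅_n` maps homomorphically, hence injectively, to `T`. -/
def ContainsMemberB (n : ℕ) : Prop :=
  ∃ B ∈ (linear n).familyB, Nonempty (B.2.Adj →r T.Adj)

/-- The family `f` of vertices has the edges in `T` which the pair `e` prescribes in `Δ(C, X)`
when `e ∈ X`. -/
def Respects {I : Type*} (C : Tournament I) (f : I → Fin 2 → V) (e : Pair) : Prop :=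
  match e with
  | ((0, k), (0, l)) => ∀ i, T.Adj (f i k) (f i l)
  | ((0, k), (1, l)) => ∀ ⦃i j⦄, C.Adj i j → T.Adj (f i k) (f j l)
  | ((1, k), (0, l)) => ∀ ⦃i j⦄, C.Adj i j → T.Adj (f j k) (f i l)
  | ((1, _), (1, _)) => True

variable {T} {N n : ℕ} {p q : Fin N → V}

theorem containsMemberB_of_forall_respects {X : Finset Pair} {hX : IsGood X}
    (hB : ⟨_, (linear n).deltaTournament X hX⟩ ∈ (linear n).familyB) (hn : n ≤ N)
    {f : Fin N → Fin 2 → V} (hf : ∀ e ∈ X, T.Respects (linear N) f e) : T.ContainsMemberB n := by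
  have hφ := Fin.strictMono_castLE hn
  refine ⟨_, hB, ⟨fun s => f (s.1.castLE hn) s.2, ?_⟩⟩
  rintro ⟨i, k⟩ ⟨j, l⟩ (⟨rfl, he⟩ | ⟨hij, he⟩ | ⟨hij, he⟩)
  exacts [hf _ he _, hf _ he (hφ hij), hf _ he (hφ hij)]

theorem containsMemberB_of_TT (hn : n ≤ N) (h : T.PointwiseAdj p q) (hp : T.Forward p p)
    (hq : T.Forward q q) (hpq : T.Backward p q) (hqp : T.Backward q p) : T.ContainsMemberB n := by
  have hB : ⟨_, (linear n).TT⟩ ∈ (linear n).familyB := by simp [familyB]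
  refine containsMemberB_of_forall_respects hB hn (f := fun i => ![p i, q i]) ?_
  simp only [Finset.forall_mem_insert, Finset.mem_singleton, forall_eq]
  exact ⟨hpq, hqp, hq, hp, h⟩

theorem containsMemberB_of_UT (hn : n ≤ N) (h : T.PointwiseAdj p q) (hp : T.Forward p p)
    (hq : T.Backward q q) (hpq : T.Forward p q) (hqp : T.Forward q p) : T.ContainsMemberB n := by
  have hB : ⟨_, (linear n).UT⟩ ∈ (linear n).familyB := by simp [familyB]
  refine containsMemberB_of_forall_respects hB hn (f := fun i => ![p i, q i]) ?_
  simp only [Finset.forall_mem_insert, Finset.mem_singleton, forall_eq]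
  exact ⟨hpq, hqp, hq, hp, h⟩

theorem containsMemberB_of_HT (hn : n ≤ N) (h : T.PointwiseAdj p q) (hp : T.Forward p p)
    (hq : T.Forward q q) (hpq : T.Backward p q) (hqp : T.Forward q p) : T.ContainsMemberB n := by
  have hB : ⟨_, (linear n).HT⟩ ∈ (linear n).familyB := by simp [familyB]
  refine containsMemberB_of_forall_respects hB hn (f := fun i => ![p i, q i]) ?_
  simp only [Finset.forall_mem_insert, Finset.mem_singleton, forall_eq]
  exact ⟨hpq, hqp, hq, hp, h⟩

theorem containsMemberB_of_KT (hn : n ≤ N) (h : T.PointwiseAdj p q) (hp : T.Forward p p)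
    (hq : T.Backward q q) (hpq : T.Backward p q) (hqp : T.Forward q p) : T.ContainsMemberB n := by
  have hB : ⟨_, (linear n).KT⟩ ∈ (linear n).familyB := by simp [familyB]
  refine containsMemberB_of_forall_respects hB hn (f := fun i => ![p i, q i]) ?_
  simp only [Finset.forall_mem_insert, Finset.mem_singleton, forall_eq]
  exact ⟨hpq, hqp, hq, hp, h⟩

theorem containsMemberB_of_VT (hn : n ≤ N) (h : T.Interleaved p q) {a : V}
    (hp : ∀ i, T.Adj a (p i)) (hq : ∀ i, T.Adj (q i) a) : T.ContainsMemberB n := by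
  replace h := h.comp_strictMono (Fin.strictMono_castLE hn)
  refine ⟨⟨_, (linear n).VT⟩, by simp [familyB],
    ⟨fun s => s.elim a fun b => ![p (b.1.castLE hn), q (b.1.castLE hn)] b.2, ?_⟩⟩
  rintro (_ | ⟨i, k⟩) (_ | ⟨j, l⟩) hab
  · exact hab.elim
  · obtain rfl : l = 0 := hab
    exact hp _
  · obtain rfl : k = 1 := hab
    exact hq _
  · rcases hab with hij | ⟨rfl, hkl⟩
    · fin_cases k <;> fin_cases l
      exacts [h.left hij, h.left_right hij, h.right_left hij, h.right hij]
    · obtain ⟨rfl, rfl⟩ : k = 0 ∧ l = 1 := by lia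
      exact h.adj i

theorem containsMemberB_of_C3 {a b c : Fin N → V} (hn : n ≤ N) (hab : T.Interleaved a b)
    (hbc : T.Interleaved b c) (hca : T.Interleaved c a) : T.ContainsMemberB n := by
  have hφ := Fin.strictMono_castLE hn
  replace hab := hab.comp_strictMono hφ
  replace hbc := hbc.comp_strictMono hφ
  replace hca := hca.comp_strictMono hφ
  refine ⟨⟨_, (linear n).C3⟩, by simp [familyB],
    ⟨fun s => ![a (s.1.castLE hn), b (s.1.castLE hn), c (s.1.castLE hn)] s.2, ?_⟩⟩
  rintro ⟨i, k⟩ ⟨j, l⟩ (hij | ⟨e, hkl⟩)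
  · fin_cases k <;> fin_cases l
    exacts [hab.left hij, hab.left_right hij, hca.right_left hij, hab.right_left hij,
      hab.right hij, hbc.left_right hij, hca.left_right hij, hbc.right_left hij, hca.left hij]
  · obtain rfl : i = j := e
    obtain rfl : l = k + 1 := hkl
    fin_cases k
    exacts [hab.adj i, hbc.adj i, hca.adj i]

end Patterns

section Dichotomies

variable {V : Type u} {T : Tournament V} {N n : ℕ} {p q : Fin (N + 1) → V}

-- Pairing `q i` with `p (i + 1)` gives the pattern `U`, with the roles of `p` and `q` exchanged.
theorem containsMemberB_of_backward_forward (hn : n ≤ N) (h : T.PointwiseAdj p q)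
    (hp : T.Backward p p) (hq : T.Forward q q) (hpq : T.Forward p q) (hqp : T.Forward q p) :
    T.ContainsMemberB n :=
  containsMemberB_of_UT (p := q ∘ Fin.castSucc) (q := p ∘ Fin.succ) hn
    (fun _ => hqp Fin.castSucc_lt_succ) (hq.comp_strictMono Fin.strictMono_castSucc)
    (hp.comp_strictMono Fin.strictMono_succ)
    (fun _ _ hij => hqp (Fin.castSucc_lt_succ_iff.2 hij.le))
    fun _ _ hij => h.adj_of_le hpq (Fin.succ_le_castSucc_iff.2 hij)

theorem dominates_of_forward_backward (hT : ¬ T.ContainsMemberB n) (hn : n ≤ N)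
    (h : T.PointwiseAdj p q) (hp : T.Forward p p) (hq : T.Backward q q)
    (hpq : T.Forward p q ∨ T.Backward p q) (hqp : T.Forward q p ∨ T.Backward q p) :
    T.Dominates p q := by
  have hn' : n ≤ N + 1 := hn.trans N.le_succ
  have hrev := Fin.rev_strictAnti (n := N + 1)
  rcases hpq with hpq | hpq <;> rcases hqp with hqp | hqp
  · exact (hT (containsMemberB_of_UT hn' h hp hq hpq hqp)).elim
  · exact h.dominates hpq hqp
  · exact (hT (containsMemberB_of_KT hn' h hp hq hpq hqp)).elim
  · exact (hT (containsMemberB_of_backward_forward hn (fun i => h i.rev) (hp.comp_strictAnti hrev)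
      (hq.comp_strictAnti hrev) (hqp.comp_strictAnti hrev) (hpq.comp_strictAnti hrev))).elim

theorem dominates_of_backward_forward (hT : ¬ T.ContainsMemberB n) (hn : n ≤ N)
    (h : T.PointwiseAdj p q) (hp : T.Backward p p) (hq : T.Forward q q)
    (hpq : T.Forward p q ∨ T.Backward p q) (hqp : T.Forward q p ∨ T.Backward q p) :
    T.Dominates p q := by
  have hrev := Fin.rev_strictAnti (n := N + 1)
  refine Dominates.of_comp_surjective (dominates_of_forward_backward hT hn (fun i => h i.rev)
    (hp.comp_strictAnti hrev) (hq.comp_strictAnti hrev) ?_ ?_) Fin.rev_surjective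
  · exact hqp.symm.imp (·.comp_strictAnti hrev) (·.comp_strictAnti hrev)
  · exact hpq.symm.imp (·.comp_strictAnti hrev) (·.comp_strictAnti hrev)

theorem dominates_or_interleaved_of_forward {p q : Fin N → V} (hT : ¬ T.ContainsMemberB n)
    (hn : n ≤ N) (h : T.PointwiseAdj p q) (hp : T.Forward p p) (hq : T.Forward q q)
    (hpq : T.Forward p q ∨ T.Backward p q) (hqp : T.Forward q p ∨ T.Backward q p) :
    T.Dominates p q ∨ T.Interleaved p q := by
  rcases hpq with hpq | hpq <;> rcases hqp with hqp | hqp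
  · exact .inr ⟨h, hp, hq, hpq, hqp⟩
  · exact .inl (h.dominates hpq hqp)
  · exact (hT (containsMemberB_of_HT hn h hp hq hpq hqp)).elim
  · exact (hT (containsMemberB_of_TT hn h hp hq hpq hqp)).elim

theorem Interleaved.containsMemberB_of_between (h : T.Interleaved p q) (hn : n ≤ N) {z : V}
    (hz : ∀ i, T.Adj (p i) z ∧ T.Adj z (q i)) : T.ContainsMemberB n :=
  containsMemberB_of_VT hn h.shift (fun _ => (hz _).2) fun _ => (hz _).1

end Dichotomies

section Homogeneity

variable {V : Type u} (T : Tournament V)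

/-- The adjacency of the vertices `w k i` and `w l j` is the same for all `i < j`. -/
def Homogeneous {ι I : Type*} [LT I] (w : ι → I → V) : Prop :=
  ∀ k l, T.Forward (w k) (w l) ∨ T.Backward (w k) (w l) ∨ ∀ i j, i < j → w k i = w l j

variable {T} {ι : Type*} {N n : ℕ} {w : ι → Fin (N + 3) → V}

theorem Homogeneous.forward_or_backward (hw : T.Homogeneous w) (k : ι) {l : ι}
    (hl : Function.Injective (w l)) : T.Forward (w k) (w l) ∨ T.Backward (w k) (w l) := by
  refine (or_assoc.2 (hw k l)).resolve_right fun h => ?_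
  have h01 : (0 : Fin (N + 3)) < 1 := Fin.mk_lt_mk.2 one_pos
  have h12 : (1 : Fin (N + 3)) < 2 := Fin.mk_lt_mk.2 one_lt_two
  exact h12.ne (hl ((h 0 1 h01).symm.trans (h 0 2 (h01.trans h12))))

theorem Homogeneous.forward_or_backward_or_eq (hw : T.Homogeneous w) (k : ι) :
    T.Forward (w k) (w k) ∨ T.Backward (w k) (w k) ∨ ∀ i j, w k i = w k j := by
  refine (hw k k).imp_right (Or.imp_right fun h i j => ?_)
  rcases lt_trichotomy i j with hij | rfl | hij
  exacts [h i j hij, rfl, (h j i hij).symm]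

theorem Homogeneous.dominates_or_interleaved_of_forward_left (hw : T.Homogeneous w)
    (hT : ¬ T.ContainsMemberB n) (hn : n ≤ N + 2) {k l : ι} (h : T.PointwiseAdj (w k) (w l))
    (hk : T.Forward (w k) (w k)) : T.Dominates (w k) (w l) ∨ T.Interleaved (w k) (w l) := by
  have hlk := hw.forward_or_backward l hk.injective
  rcases hw.forward_or_backward_or_eq l with hl | hl | hl
  · exact dominates_or_interleaved_of_forward hT (hn.trans (N + 2).le_succ) h hk hl
      (hw.forward_or_backward k hl.injective) hlk
  · exact .inl (dominates_of_forward_backward hT hn h hk hl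
      (hw.forward_or_backward k hl.injective) hlk)
  · exact .inl fun i j => hl i j ▸ h i

theorem Homogeneous.dominates_or_interleaved_of_forward_right (hw : T.Homogeneous w)
    (hT : ¬ T.ContainsMemberB n) (hn : n ≤ N + 2) {k l : ι} (h : T.PointwiseAdj (w k) (w l))
    (hl : T.Forward (w l) (w l)) : T.Dominates (w k) (w l) ∨ T.Interleaved (w k) (w l) := by
  have hkl := hw.forward_or_backward k hl.injective
  rcases hw.forward_or_backward_or_eq k with hk | hk | hk
  · exact dominates_or_interleaved_of_forward hT (hn.trans (N + 2).le_succ) h hk hl hkl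
      (hw.forward_or_backward l hk.injective)
  · exact .inl (dominates_of_backward_forward hT hn h hk hl hkl
      (hw.forward_or_backward l hk.injective))
  · exact .inl fun i j => hk j i ▸ h j

theorem Homogeneous.containsMemberB_of_triangle (hw : T.Homogeneous w) (hn : n ≤ N + 2)
    {x y u : ι} (hxy : T.Interleaved (w x) (w y)) (hyu : T.PointwiseAdj (w y) (w u))
    (hux : T.PointwiseAdj (w u) (w x)) : T.ContainsMemberB n := by
  by_contra hT
  have hn' : n ≤ N + 3 := hn.trans (N + 2).le_succ
  rcases interleaved_or_exists_between
    (hw.dominates_or_interleaved_of_forward_left hT hn hyu hxy.right)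
    (hw.dominates_or_interleaved_of_forward_right hT hn hux hxy.left) with ⟨hyu, hux⟩ | ⟨t, ht⟩
  · exact hT (containsMemberB_of_C3 hn' hxy hyu hux)
  · exact hT (containsMemberB_of_VT hn' hxy (fun i => (ht i).2) fun i => (ht i).1)

theorem Homogeneous.interleaved_of_mem_openInterval (hw : T.Homogeneous w)
    (hT : ¬ T.ContainsMemberB n) (hn : n ≤ N + 2) {x y z : ι} (hxy : T.Interleaved (w x) (w y))
    (hz : ∀ i, w z i ∈ T.openInterval (w x i) (w y i)) :
    T.Interleaved (w x) (w z) ∧ T.Interleaved (w z) (w y) := by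
  have hxz := hw.dominates_or_interleaved_of_forward_left hT hn (fun i => (hz i).1) hxy.left
  have hzy := hw.dominates_or_interleaved_of_forward_right hT hn (fun i => (hz i).2) hxy.right
  exact (interleaved_or_exists_between hxz hzy).resolve_right fun ⟨t, ht⟩ =>
    hT (hxy.containsMemberB_of_between hn ht)

theorem Homogeneous.containsMemberB_of_cycle (hw : T.Homogeneous w) (hn : n ≤ N + 2)
    {x y a b c : ι} (hxy : T.Interleaved (w x) (w y))
    (h : ∀ i, T.IsObstruction (w x i) (w y i) (w a i) (w b i) (w c i) .cycle) :
    T.ContainsMemberB n := by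
  by_contra hT
  have hxa := (hw.interleaved_of_mem_openInterval hT hn hxy fun i => (h i).1.1).1
  have hxb := (hw.interleaved_of_mem_openInterval hT hn hxy fun i => (h i).1.2.1).1
  have hxc := (hw.interleaved_of_mem_openInterval hT hn hxy fun i => (h i).1.2.2).1
  have key : ∀ {k l : ι}, T.Interleaved (w x) (w k) → T.Interleaved (w x) (w l) →
      T.PointwiseAdj (w k) (w l) → T.Interleaved (w k) (w l) := fun {k l} hk hl hkl =>
    (hw.dominates_or_interleaved_of_forward_left hT hn hkl hk.right).resolve_left fun hdom =>
      hT (hl.containsMemberB_of_between hn fun i => ⟨hk.adj_of_le (Fin.le_last i), hdom _ i⟩)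
  exact hT (containsMemberB_of_C3 (hn.trans (N + 2).le_succ) (key hxa hxb fun i => (h i).2.1)
    (key hxb hxc fun i => (h i).2.2.1) (key hxc hxa fun i => (h i).2.2.2))

theorem Homogeneous.containsMemberB_of_isObstruction (hw : T.Homogeneous w) (hn : n ≤ N + 2)
    {x y a b c : ι} (hxy : T.Interleaved (w x) (w y)) {k : ObstructionKind}
    (h : ∀ i, T.IsObstruction (w x i) (w y i) (w a i) (w b i) (w c i) k) :
    T.ContainsMemberB n := by
  by_contra hT
  cases k with
  | triangle =>
    exact hT (hw.containsMemberB_of_triangle hn hxy (fun i => (h i).1) fun i => (h i).2)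
  | cycle => exact hT (hw.containsMemberB_of_cycle hn hxy h)
  | lower =>
    have hxa := (hw.interleaved_of_mem_openInterval hT hn hxy fun i => (h i).1).1
    exact hT (hw.containsMemberB_of_triangle hn hxa (fun i => (h i).2.1) fun i => (h i).2.2)
  | upper =>
    have hay := (hw.interleaved_of_mem_openInterval hT hn hxy fun i => (h i).1).2
    exact hT (hw.containsMemberB_of_triangle hn hay (fun i => (h i).2.1) fun i => (h i).2.2)

end Homogeneity

section Extraction

theorem exists_homogeneous_comp (ι : Type*) [Finite ι] (N : ℕ) :
    ∃ M : ℕ, ∀ {V : Type u} (T : Tournament V) (w : ι → Fin M → V),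
      ∃ g : Fin N ↪o Fin M, T.Homogeneous fun k => w k ∘ g := by
  obtain ⟨M, hM⟩ := exists_orderEmbedding_pairwise_const (ι → ι → Prop × Prop) N
  refine ⟨M, fun T w => ?_⟩
  obtain ⟨g, r, hr⟩ := hM fun i j k l => (T.Adj (w k i) (w l j), T.Adj (w l j) (w k i))
  refine ⟨g, fun k l => ?_⟩
  have hfwd : ∀ i j, i < j → (T.Adj (w k (g i)) (w l (g j)) ↔ (r k l).1) := fun i j hij => by
    rw [← hr i j hij]
  have hbwd : ∀ i j, i < j → (T.Adj (w l (g j)) (w k (g i)) ↔ (r k l).2) := fun i j hij => by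
    rw [← hr i j hij]
  by_cases h₁ : (r k l).1
  · exact .inl fun i j hij => (hfwd i j hij).2 h₁
  by_cases h₂ : (r k l).2
  · exact .inr (.inl fun i j hij => (hbwd i j hij).2 h₂)
  · exact .inr (.inr fun i j hij => T.trichotomous.trichotomous _ _
      (mt (hfwd i j hij).1 h₁) (mt (hbwd i j hij).1 h₂))

theorem exists_forward (N : ℕ) : ∃ M : ℕ, ∀ {V : Type u} (T : Tournament V),
    (M : ℕ∞) ≤ ENat.card V → ∃ s : Fin N → V, T.Forward s s := by
  obtain ⟨M, hM⟩ := exists_homogeneous_comp Unit N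
  refine ⟨M, fun {V} T hV => ?_⟩
  obtain ⟨f, -⟩ := Fin.Embedding.exists_embedding_disjoint_range_of_add_le_ENat_card
    (s := (∅ : Set V)) (n := M) (by simpa using hV)
  obtain ⟨g, hg⟩ := hM T fun _ => f
  rcases hg () () with h | h | h
  · exact ⟨_, h⟩
  · exact ⟨_, h.comp_strictAnti Fin.rev_strictAnti⟩
  · exact ⟨f ∘ g, fun i j hij => (hij.ne (g.injective (f.injective (h i j hij)))).elim⟩

theorem exists_containsMemberB (n : ℕ) : ∃ a : ℕ, ∀ {V : Type u} (T : Tournament V),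
    (a : ℕ∞) ≤ ENat.card V → T.IsAcyclicallyIndecomposable → T.ContainsMemberB n := by
  have := Fintype.ofFinite ObstructionKind
  have : Nonempty ObstructionKind := ⟨.triangle⟩
  obtain ⟨M, hM⟩ := exists_homogeneous_comp (Fin 5) (n + 3)
  obtain ⟨a, ha⟩ := exists_forward (2 * (Fintype.card ObstructionKind * M))
  refine ⟨a, fun T hV hT => ?_⟩
  obtain ⟨s, hs⟩ := ha T hV
  have hxy := hs.interleaved_even_odd
  set x : Fin _ → _ := fun i => s ⟨2 * i, _⟩
  set y : Fin _ → _ := fun i => s ⟨2 * i + 1, _⟩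
  choose a b c k hk using fun i => hT.exists_isObstruction (hxy.adj i)
  obtain ⟨e, k₀, he⟩ := exists_orderEmbedding_const k (S := Finset.univ) (n := M) (by simp)
  obtain ⟨g, hg⟩ := hM T ![x ∘ e, y ∘ e, a ∘ e, b ∘ e, c ∘ e]
  refine hg.containsMemberB_of_isObstruction (x := 0) (y := 1) (a := 2) (b := 3) (c := 4)
    (k := k₀) (n.le_add_right 2) (hxy.comp_strictMono (e.strictMono.comp g.strictMono)) fun i => ?_
  rw [← (he (g i)).2]
  exact hk (e (g i))

end Extraction

end Tournament

theorem theorem3_general (n : ℕ) :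
    ∃ a : ℕ, ∀ (V : Type u) (T : Tournament V),
      (a : ℕ∞) ≤ ENat.card V → T.IsAcyclicallyIndecomposable →
        ∃ B ∈ (Tournament.linear n).checkFamilyB, B.2.IsEmbeddableInto T := by
  obtain ⟨a, ha⟩ := Tournament.exists_containsMemberB n
  refine ⟨a, fun V T hV hT => ?_⟩
  obtain ⟨B, hB, ⟨f⟩⟩ := ha T hV hT
  obtain ⟨r⟩ := Tournament.nonempty_relHom_check B.2
  exact ⟨_, ⟨B, hB, rfl⟩, Tournament.isEmbeddableInto_of_relHom (f.comp r)⟩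

theorem theorem3 (n : ℕ) :
    ∃ a : ℕ, ∀ (V : Type u) [Finite V] (T : Tournament V),
      a ≤ Nat.card V → T.IsAcyclicallyIndecomposable →
        ∃ B ∈ (Tournament.linear n).checkFamilyB, B.2.IsEmbeddableInto T := by
  obtain ⟨a, ha⟩ := theorem3_general.{u} n
  exact ⟨a, fun V _ T hV => ha V T (by rw [ENat.card_eq_coe_natCard]; exact_mod_cast hV)⟩
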